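/- **Setting.** Let $\epsilon_0=(1,0)$, $\epsilon_1=(0,1)$, $\epsilon_2=(-1,0)$, $\epsilon_3=(0,-1)$; positions $p,q\in\mathbb Z^2$ are adjacent if $q=p+\epsilon_i$ for some $i$. A *configuration* of g-2PATH is a finite connected set $C\subset\mathbb Z^2$ containing the origin $v_{\rm gen}=(0,0)$ (the general) that is the set of positions of a path $p_0\ldots p_{n-1}$ of distinct positions in which $p_i,p_{i+1}$ are adjacent and $p_i,p_j$ are not adjacent for $i+2\le j$. We re-index it as $C=p_r\ldots p_s$ with $r\le 0\le s$ and $p_0=(0,0)$ (in either orientation). Let ${\rm d}_C$ be the distance inside $C$ and ${\rm bc}_C(p)=(b_0,\dots,b_3)\in\{0,1\}^4$ with $b_i=1$ iff $p+\epsilon_i\in C$. An *automaton* has a state set, a quiescent state ${\rm Q}$, a general state ${\rm G}_{\mathbf b}\ne{\rm Q}$ for each $\mathbf b\in\{0,1\}^4$, a set $\mathcal F\not\ni{\rm Q}$ of firing states, and a transition function giving the next state of a node from its state and its four inputs (the state of the node in each direction, or $\#$ if there is no node); a node in state ${\rm Q}$ all of whose inputs are ${\rm Q}$ or $\#$ stays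 in ${\rm Q}$. When copies of it are placed at the nodes of $C$, at time $0$ the general is in ${\rm G}_{{\rm bc}_C(v_{\rm gen})}$ and all other nodes are in ${\rm Q}$. The automaton *fires $C$ at time $t$* if all nodes of $C$ are in $\mathcal F$ at time $t$ and no node is in $\mathcal F$ before $t$. A *solution* of g-2PATH is a finite automaton that fires every configuration at some time. A *partial solution* is a finite automaton such that, for every configuration $C$, either it fires $C$ at some time, or no node of $C$ is ever in $\mathcal F$; its *domain* is the set of the configurations that it fires. ${\rm mft}(C)$ is the minimum, over all solutions of g-2PATH, of the time at which the solution fires $C$. The *available information* ${\rm ai}(v,t,C)$ is ${\rm Q}$ if ${\rm d}_C(v_{\rm gen},v)>t$, and otherwise the triple of $t$, $v$ and the set of all $(v',{\rm bc}_C(v'))$ with $v'\in C$ and ${\rm d}_C(v_{\rm gen},v')+{\rm d}_C(v',v)\le t$. Write $C\equiv_t' C'$ if ${\rm ai}(v,t,C)={\rm ai}(v,t,C')\neq{\rm Q}$ for some $v\in C\cap C'$, and let $\equiv_t$ be the reflexive transitive closure of $\equiv'_t$. **The automaton $A_{{\rm cc},C}$.** Let $C$ be a configuration, $T={\rm mft}(C)$,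 and let $C_0=C,C_1,\dots,C_{m-1}$ be all the configurations $C'$ with $C\equiv_T C'$. For $C_k=p_r\ldots p_s$ and $r\le u\le s$ put $a=\max\{r,\lceil (u-T)/2\rceil\}$ and $b=\min\{s,\lfloor (u+T)/2\rfloor\}$. The automaton $A_0(u,C_k)$, with state set $\{{\rm X},{\rm Q}\}\times\{{\rm X}',{\rm Q}\}\times\{0,1,\dots,T,{\rm Q}\}$, works as follows when its copies are placed at the nodes of a configuration $C'$. The third component is a clock which starts with value $0$ at the general at time $0$ and spreads to all nodes with speed $1$; from time $T+1$ on all nodes are quiescent. The first component represents signals ${\rm R},{\rm S}$: the signal ${\rm R}$ starts at $p_0$ at time $0$ and moves with speed $1$ along $p_0,p_{-1},\dots,p_a$, checking at each of these positions $p_j$, $p_a$ included, that the boundary condition of the node is ${\rm bc}_{C_k}(p_j)$, and vanishing if it is not; if all checks succeed, then at time $-a$ a signal ${\rm S}$ is generated at $p_a$, which spreads in all directions with speed $1$. The second component represents signals ${\rm R}',{\rm S}'$, which do the same for $p_0,p_1,\dots,p_b$, ${\rm S}'$ being generated at $p_b$ at time $b$. A node is in a firing state iff its clock shows $T$ and it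 has received both ${\rm S}$ and ${\rm S}'$. The automaton $A_{{\rm cc},C}$ simulates, with one common clock, the automata $A_0(u,C_k)$ for all $C_k$ and all nodes $p_u$ of $C_k$, and a node is in a firing state iff it is so in at least one of them. **Theorem.** For every configuration $C$ of g-2PATH, with $T={\rm mft}(C)$, there are only finitely many configurations $C'$ with $C\equiv_T C'$, and, writing them as $C_0,\dots,C_{m-1}$: 1. $A_{{\rm cc},C}$ is a partial solution of g-2PATH (in particular, a finite automaton); 2. the domain of $A_{{\rm cc},C}$ is $\{C_0,\dots,C_{m-1}\}$; 3. $A_{{\rm cc},C}$ fires $C'$ at time $T$ for every $C'$ in its domain. -/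

import Mathlib

namespace FSSP

/-! ### Positions, boundary conditions, configurations of g-2PATH -/

/-- Positions of the two-dimensional grid space. -/
abbrev Pos := ℤ × ℤ

/-- The four unit vectors: east, north, west, south. -/
def dir : Fin 4 → Pos := ![(1, 0), (0, 1), (-1, 0), (0, -1)]

theorem exists_neg_dir (i : Fin 4) : ∃ j, dir j = -dir i := by
  fin_cases i
  · exact ⟨2, by simp [dir]⟩
  · exact ⟨3, by simp [dir]⟩
  · exact ⟨0, by simp [dir]⟩
  · exact ⟨1, by simp [dir]⟩

theorem dir_ne_zero (i : Fin 4) : dir i ≠ 0 := by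
  fin_cases i <;> simp [dir]

/-- Adjacency of positions. -/
def grid : SimpleGraph Pos where
  Adj p q := ∃ i, q = p + dir i
  symm := ⟨by
    rintro p q ⟨i, rfl⟩
    obtain ⟨j, hj⟩ := exists_neg_dir i
    exact ⟨j, by rw [hj]; simp⟩⟩
  loopless := ⟨by
    rintro p ⟨i, hi⟩
    exact dir_ne_zero i (by simpa using hi)⟩

open Classical in
/-- The boundary condition of `p` in `C`: which of the four adjacent positions are in `C`. -/
noncomputable def bc (C : Set Pos) (p : Pos) : Fin 4 → Bool := fun i => decide (p + dir i ∈ C)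

/-- Configurations of 2REG: finite connected sets of positions that contain the origin,
which is the position of the general. -/
def IsRegion (C : Set Pos) : Prop :=
  C.Finite ∧ (0 : Pos) ∈ C ∧ (grid.induce C).Connected

/-- `C` is the set of positions of a path `p 0, …, p (n - 1)` that neither crosses nor
touches itself. -/
def IsSimplePath (C : Set Pos) : Prop :=
  ∃ (n : ℕ) (p : ℕ → Pos),
    C = p '' {i | i < n} ∧
    (∀ i, i + 1 < n → grid.Adj (p i) (p (i + 1))) ∧
    (∀ i j, i < n → j < n → p i = p j → i = j) ∧
    (∀ i j, i + 2 ≤ j → j < n → ¬ grid.Adj (p i) (p j))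

/-- Configurations of g-2PATH. -/
structure Config where
  carrier : Set Pos
  isRegion : IsRegion carrier
  isSimplePath : IsSimplePath carrier

/-- The nodes of a configuration. -/
abbrev Config.Node (C : Config) := {v : Pos // v ∈ C.carrier}

/-- The general. -/
def Config.gen (C : Config) : C.Node := ⟨0, C.isRegion.2.1⟩

/-- The distance between two nodes in `C` (along paths inside `C`). -/
noncomputable def Config.d (C : Config) (v w : C.Node) : ℕ := (grid.induce C.carrier).dist v w

/-- A way to write the configuration `D` as a path `p r, …, p 0, …, p s` with `p 0` the
general (there are in general two, according to the orientation).  Only the values of `p` on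
the interval from `r` to `s` are meaningful. -/
structure PathRep (D : Config) where
  r : ℤ
  s : ℤ
  p : ℤ → Pos
  r_nonpos : r ≤ 0
  s_nonneg : 0 ≤ s
  p_zero : p 0 = 0
  carrier_eq : D.carrier = p '' Set.Icc r s
  adj : ∀ k, r ≤ k → k < s → grid.Adj (p k) (p (k + 1))
  inj : Set.InjOn p (Set.Icc r s)
  not_adj : ∀ i j, r ≤ i → i + 2 ≤ j → j ≤ s → ¬ grid.Adj (p i) (p j)

theorem PathRep.nonempty (D : Config) : Nonempty (PathRep D) := by
  obtain ⟨n, p, hC, hadj, hinj, hnot⟩ := D.isSimplePath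
  have h0 : (0 : Pos) ∈ p '' {i | i < n} := hC ▸ D.isRegion.2.1
  obtain ⟨k, hk, hk0⟩ := h0
  have hk' : k < n := hk
  refine ⟨⟨-(k : ℤ), (n : ℤ) - 1 - k, fun z => p (z + k).toNat, by omega, by omega,
    by simpa using hk0, ?_, ?_, ?_, ?_⟩⟩
  · rw [hC]
    ext v
    constructor
    · rintro ⟨i, hi, rfl⟩
      have hi' : i < n := hi
      exact ⟨(i : ℤ) - k, ⟨by omega, by omega⟩, by simp⟩
    · rintro ⟨z, ⟨hz1, hz2⟩, rfl⟩
      exact ⟨(z + k).toNat, show (z + k).toNat < n by omega, rfl⟩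
  · intro z hz1 hz2
    have := hadj (z + k).toNat (by omega)
    have e : (z + 1 + k).toNat = (z + k).toNat + 1 := by omega
    simpa only [e] using this
  · rintro i ⟨hi1, hi2⟩ j ⟨hj1, hj2⟩ h
    have := hinj _ _ (by omega) (by omega) h
    omega
  · intro i j hi hij hj
    exact hnot _ _ (by omega) (by omega)

/-! ### Automata, in the boundary-sensitive model -/

/-- A possibly infinite automaton.  `next` takes the state of the node and the four inputs; the
input from a direction without a node is `none` (the symbol `#`), otherwise it is the state of
the node there.  The state of the general at time `0` depends on its boundary condition. -/
structure Automaton where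
  State : Type
  quiescent : State
  general : (Fin 4 → Bool) → State
  firing : Set State
  next : State → (Fin 4 → Option State) → State
  general_ne : ∀ b, general b ≠ quiescent
  quiescent_not_firing : quiescent ∉ firing
  next_quiescent : ∀ inp : Fin 4 → Option State,
    (∀ i, inp i = none ∨ inp i = some quiescent) → next quiescent inp = quiescent

open Classical in
/-- `st A C t v` is the state of the node `v` at time `t` when copies of `A` are placed at the
nodes of `C`. -/
noncomputable def st (A : Automaton) (C : Config) : ℕ → C.Node → A.State
  | 0, v => if v = C.gen then A.general (bc C.carrier 0) else A.quiescent
  | t + 1, v => A.next (st A C t v) fun i =>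
      if h : v.1 + dir i ∈ C.carrier then some (st A C t ⟨v.1 + dir i, h⟩) else none

/-- All nodes of `C` fire at time `t`, and no node fires before. -/
def FiresAt (A : Automaton) (C : Config) (t : ℕ) : Prop :=
  ∀ v : C.Node, (∀ t' < t, st A C t' v ∉ A.firing) ∧ st A C t v ∈ A.firing

/-- Solutions of g-2PATH (by finite automata). -/
def IsSolution (A : Automaton) : Prop :=
  Finite A.State ∧ ∀ C : Config, ∃ t, FiresAt A C t

/-- Partial solutions of g-2PATH (by finite automata). -/
def IsPartialSolution (A : Automaton) : Prop :=
  Finite A.State ∧ ∀ C : Config,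
    (∃ t, FiresAt A C t) ∨ ∀ (v : C.Node) (t : ℕ), st A C t v ∉ A.firing

/-- The domain of a partial solution. -/
def domain (A : Automaton) : Set Config := {C | ∃ t, FiresAt A C t}

/-- `T` is the minimum firing time of `C`: the minimum, over all solutions of g-2PATH, of the
firing time for `C`. -/
def IsMinFiringTime (C : Config) (T : ℕ) : Prop :=
  IsLeast {t | ∃ A : Automaton, IsSolution A ∧ FiresAt A C t} T

/-! ### Available information and the equivalence of configurations -/

open Classical in
/-- The available information at the node `v` of `C` at time `t`; `none` is the letter `Q`. -/
noncomputable def ai (C : Config) (v : C.Node) (t : ℕ) :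
    Option (ℕ × Pos × Set (Pos × (Fin 4 → Bool))) :=
  if C.d C.gen v ≤ t then
    some (t, v.1, {x | ∃ v' : C.Node,
      C.d C.gen v' + C.d v' v ≤ t ∧ x = (v'.1, bc C.carrier v'.1)})
  else none

/-- The one-step relation at time `t`: some common node has the same available information,
different from `Q`, in both configurations. -/
def Step (t : ℕ) (C C' : Config) : Prop :=
  ∃ (v : Pos) (h : v ∈ C.carrier) (h' : v ∈ C'.carrier),
    ai C ⟨v, h⟩ t = ai C' ⟨v, h'⟩ t ∧ ai C ⟨v, h⟩ t ≠ none

/-- The relation generated by finitely many (possibly zero) steps at time `t`. -/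
def Equivalent (t : ℕ) : Config → Config → Prop := Relation.ReflTransGen (Step t)

/-! ### The automata checking consistency -/

/-- The left end of the part `p a, …, p b` of `D` which is the set of the nodes `v'` with
`d gen v' + d v' (p u) ≤ T`; here `-((T - u) / 2)` is `(u - T) / 2` rounded up. -/
def PathRep.a {D : Config} (ρ : PathRep D) (T : ℕ) (u : ℤ) : ℤ := max ρ.r (-((T - u) / 2))

/-- The right end of that part (the division rounds down). -/
def PathRep.b {D : Config} (ρ : PathRep D) (T : ℕ) (u : ℤ) : ℤ := min ρ.s ((u + T) / 2)

/-- Clock values: `0, …, T`, or `none`. -/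
abbrev Clock (T : ℕ) := Option (Fin (T + 1))

/-- The clock of the node itself or of one of its neighbours shows `m`. -/
def ReadsClock {T : ℕ} (own : Clock T) (inp : Fin 4 → Option (Clock T)) (m : Fin (T + 1)) : Prop :=
  own = some m ∨ ∃ i, inp i = some (some m)

open Classical in
/-- The time shown in the neighbourhood, if it is less than `T`.  In an actual run all clocks
that are shown at the same time agree. -/
noncomputable def readTime {T : ℕ} (own : Clock T) (inp : Fin 4 → Option (Clock T)) :
    Option (Fin T) :=
  if h : ∃ m : Fin T, ReadsClock own inp m.castSucc then some h.choose else none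

/-- Behaviour of the pair of signals `R`, `S` belonging to the part `q 0, …, q l` of `D`, when
time changes from `t` to `t + 1`.  The bit is `true` at time `t` if the node is in the state
`R` (when `t < l`) or `S` (when `l ≤ t`).  Until it arrives at `q l` the signal runs along `q`
and checks boundary conditions; from then on it spreads in all directions. -/
def SignalNext (D : Config) (q : ℕ → Pos) (l t : ℕ) (own : Bool)
    (inp : Fin 4 → Option Bool) : Prop :=
  if t + 1 ≤ l then
    (∃ i, q (t + 1) + dir i = q t ∧ inp i = some true) ∧
      (fun i => (inp i).isSome) = bc D.carrier (q (t + 1))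
  else own = true ∨ ∃ i, inp i = some true

open Classical in
/-- The automaton `A₀(u, D)` where `D` is written as `p r, …, p s`: the first bit is for the
signals `R`, `S` on `p 0, p (-1), …, p a`, the second for the signals `R'`, `S'` on
`p 0, p 1, …, p b`.  It fires at time `T` where both of `S`, `S'` have arrived. -/
noncomputable def A0 (T : ℕ) {D : Config} (ρ : PathRep D) (u : ℤ) : Automaton where
  State := (Bool × Bool) × Clock T
  quiescent := ((false, false), none)
  general β := ((decide (β = bc D.carrier 0), decide (β = bc D.carrier 0)), some 0)
  firing := {x | x = ((true, true), some (Fin.last T))}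
  next x inp :=
    match readTime x.2 (fun i => (inp i).map Prod.snd) with
    | none => ((false, false), none)
    | some t =>
      ((decide (SignalNext D (fun j => ρ.p (-(j : ℤ))) (-(ρ.a T u)).toNat t x.1.1
          fun i => (inp i).map fun y => y.1.1),
        decide (SignalNext D (fun j => ρ.p j) (ρ.b T u).toNat t x.1.2
          fun i => (inp i).map fun y => y.1.2)),
        some t.succ)
  general_ne β h := by simp at h
  quiescent_not_firing h := by simp at h
  next_quiescent inp h := by
    have hr : readTime (T := T) none (fun i => (inp i).map Prod.snd) = none := by
      unfold readTime
      rw [dif_neg]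
      rintro ⟨m, hm | ⟨i, hi⟩⟩
      · simp at hm
      · dsimp only at hi
        rcases h i with h | h <;> rw [h] at hi <;> simp at hi
    simp [hr]

/-- Pairs of a configuration `D` equivalent to `C` at time `T`, written as `p r, …, p s`, and an
index `u` of a node `p u` of `D`. -/
abbrev CCIndex (ρ : ∀ D : Config, PathRep D) (C : Config) (T : ℕ) :=
  Σ D : {D : Config // Equivalent T C D}, {u : ℤ // (ρ D.1).r ≤ u ∧ u ≤ (ρ D.1).s}

/-- The consistency-checking automaton of `C` for the time `T`: it simulates, with a common
clock, the automata `A₀(u, D)` for all `D` equivalent to `C` at time `T` and all nodes `p u` of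
`D`, and fires if and only if at least one of them fires. -/
noncomputable def Acc (ρ : ∀ D : Config, PathRep D) (C : Config) (T : ℕ) : Automaton where
  State := (CCIndex ρ C T → Bool × Bool) × Clock T
  quiescent := (fun _ => (false, false), none)
  general β := (fun x => ((A0 T (ρ x.1.1) x.2.1).general β).1, some 0)
  firing := {y | ∃ x : CCIndex ρ C T, (y.1 x, y.2) ∈ (A0 T (ρ x.1.1) x.2.1).firing}
  next y inp :=
    (fun x => ((A0 T (ρ x.1.1) x.2.1).next (y.1 x, y.2)
        fun i => (inp i).map fun z => (z.1 x, z.2)).1,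
      (readTime y.2 fun i => (inp i).map Prod.snd).map Fin.succ)
  general_ne β h := by simp at h
  quiescent_not_firing := by
    rintro ⟨x, hx⟩
    exact (A0 T (ρ x.1.1) x.2.1).quiescent_not_firing hx
  next_quiescent inp h := by
    have hr : readTime (T := T) none (fun i => (inp i).map Prod.snd) = none := by
      unfold readTime
      rw [dif_neg]
      rintro ⟨m, hm | ⟨i, hi⟩⟩
      · simp at hm
      · dsimp only at hi
        rcases h i with h | h <;> rw [h] at hi <;> simp at hi
    refine Prod.ext (funext fun x => ?_) (by simp [hr])
    have := (A0 T (ρ x.1.1) x.2.1).next_quiescent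
      (fun i => (inp i).map fun z => (z.1 x, z.2)) (fun i => by
        rcases h i with h | h <;> rw [h]
        · exact Or.inl rfl
        · exact Or.inr rfl)
    exact congrArg Prod.fst this

end FSSP

namespace FSSP

/-! ### States of neighbours and distances -/

/-! The argument combines an indistinguishability principle for arbitrary automata with a direct
analysis of the signals.

A state at time `T` depends only on the available information (`st_eq_of_ai_eq`). A solution that
fires `C` at `T` therefore fires at `T` every configuration one step away, hence the whole
equivalence class. Since an unreached node is quiescent, all nodes of these configurations lie
within distance `T` of the general. So the class is finite, and every index `u` that occurs
satisfies `|u| ≤ T`.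

Distance along a simple path is difference of indices, so what `p u` knows at time `T` is exactly
the segment `p a, …, p b` with its boundary conditions. If `A0 T ρ u` fires somewhere in `E`, both
signals have certified that this segment lies in `E` with the same boundary conditions. By
`PathRep.step_of_bc_eq` this already forces equal available information, so `E` is one step from `D`
and stays in the class. Conversely, on `D` itself the signals reach `p u` in time (`firing_A0`): the
bounds `a` and `b` are exactly those for which the detour from the general through an end to `p u`
takes at most `T` steps. Thus every node of every member of the class is fired by its own component
of `Acc`, nothing outside the class fires, and the clock allows no firing at a time other than `T`.
-/

theorem Config.ext' {C D : Config} (h : C.carrier = D.carrier) : C = D := by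
  cases C; cases D; cases h; rfl

theorem Config.connected (C : Config) : (grid.induce C.carrier).Connected := C.isRegion.2.2

theorem grid_adj_add (p : Pos) (i : Fin 4) : grid.Adj p (p + dir i) := ⟨i, rfl⟩

theorem mem_iff_of_bc_eq {C D : Set Pos} {p q : Pos} (h : bc C p = bc D p) (hq : grid.Adj p q) :
    q ∈ C ↔ q ∈ D := by
  obtain ⟨i, rfl⟩ := hq
  simpa [bc] using congrFun h i

open Classical in
/-- The values of `f` at the neighbours of `v`, `none` where there is no node. -/
noncomputable def pull {α : Type*} {C : Config} (f : C.Node → α) (v : C.Node) :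
    Fin 4 → Option α :=
  fun i => if h : v.1 + dir i ∈ C.carrier then some (f ⟨v.1 + dir i, h⟩) else none

theorem map_pull {α β : Type*} {C : Config} (f : C.Node → α) (g : α → β) (v : C.Node) (i : Fin 4) :
    (pull f v i).map g = pull (fun w => g (f w)) v i := by
  unfold pull; split <;> rfl

theorem pull_eq_some {α : Type*} {C : Config} {f : C.Node → α} {v : C.Node} {i : Fin 4} {x : α} :
    pull f v i = some x ↔ ∃ h : v.1 + dir i ∈ C.carrier, f ⟨v.1 + dir i, h⟩ = x := by
  unfold pull; split <;> simp_all

theorem isSome_pull {α : Type*} {C : Config} (f : C.Node → α) (v : C.Node) :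
    (fun i => (pull f v i).isSome) = bc C.carrier v.1 := by
  funext i
  unfold pull bc; split <;> simp_all

theorem st_succ (A : Automaton) (C : Config) (t : ℕ) (v : C.Node) :
    st A C (t + 1) v = A.next (st A C t v) (pull (st A C t) v) := rfl

theorem dist_add_dir_le {C : Config} (v w : C.Node) (i : Fin 4) (h : v.1 + dir i ∈ C.carrier) :
    C.d ⟨v.1 + dir i, h⟩ w ≤ C.d v w + 1 := by
  have hadj : (grid.induce C.carrier).Adj ⟨v.1 + dir i, h⟩ v := (grid_adj_add v.1 i).symm
  have h1 := SimpleGraph.dist_eq_one_iff_adj.2 hadj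
  have := C.connected.dist_triangle (u := ⟨v.1 + dir i, h⟩) (v := v) (w := w)
  unfold Config.d
  omega

theorem dist_gen_le_add_dir {C : Config} (v : C.Node) (i : Fin 4) (h : v.1 + dir i ∈ C.carrier) :
    C.d C.gen v ≤ C.d C.gen ⟨v.1 + dir i, h⟩ + 1 := by
  have hadj : (grid.induce C.carrier).Adj ⟨v.1 + dir i, h⟩ v := (grid_adj_add v.1 i).symm
  have h1 := SimpleGraph.dist_eq_one_iff_adj.2 hadj
  have := C.connected.dist_triangle (u := C.gen) (v := ⟨v.1 + dir i, h⟩) (w := v)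
  unfold Config.d
  omega

/-- Information travels one edge per time unit: all inputs of a node not yet reached come from nodes
that were unreached one step earlier. -/
theorem st_eq_quiescent (A : Automaton) (C : Config) {t : ℕ} {v : C.Node}
    (h : t < C.d C.gen v) : st A C t v = A.quiescent := by
  induction t generalizing v with
  | zero =>
    have : v ≠ C.gen := by rintro rfl; simp [Config.d] at h
    simp [st, this]
  | succ t ih =>
    rw [st_succ, ih (by omega)]
    refine A.next_quiescent _ fun i => ?_
    by_cases hi : v.1 + dir i ∈ C.carrier
    · refine Or.inr (pull_eq_some.2 ⟨hi, ih ?_⟩)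
      have := dist_gen_le_add_dir v i hi
      omega
    · exact Or.inl (by simp [pull, hi])

theorem dist_gen_le_of_firesAt {A : Automaton} {C : Config} {T : ℕ} (h : FiresAt A C T)
    (v : C.Node) : C.d C.gen v ≤ T := by
  by_contra! hv
  have := (h v).2
  rw [st_eq_quiescent A C hv] at this
  exact A.quiescent_not_firing this

/-! ### Available information determines the state -/

theorem mem_and_bc_eq_of_ai_eq {C D : Config} {v : C.Node} {v' : D.Node} {T : ℕ}
    (h : ai C v T = ai D v' T) (hn : ai C v T ≠ none) {w : C.Node}
    (hw : C.d C.gen w + C.d w v ≤ T) :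
    w.1 ∈ D.carrier ∧ bc C.carrier w.1 = bc D.carrier w.1 := by
  have hn' := h ▸ hn
  unfold ai at h hn hn'
  split at hn <;> [skip; exact absurd rfl hn]
  split at hn' <;> [skip; exact absurd rfl hn']
  rw [if_pos ‹_›, if_pos ‹_›] at h
  simp only [Option.some.injEq, Prod.mk.injEq, true_and] at h
  have hm : (w.1, bc C.carrier w.1) ∈ {x | ∃ w : C.Node,
    C.d C.gen w + C.d w v ≤ T ∧ x = (w.1, bc C.carrier w.1)} := ⟨w, hw, rfl⟩
  rw [h.2] at hm
  obtain ⟨w', -, hx⟩ := hm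
  obtain ⟨h1, h2⟩ := Prod.mk.inj hx
  exact ⟨h1 ▸ w'.2, by rw [h2, h1]⟩

/-- Induction inside the backward light cone of the observing node. The distances to `v` in `C` and
to `v'` in `D` are bounded separately and never compared. -/
theorem st_eq_of_ai_eq (A : Automaton) {C D : Config} {v : C.Node} {v' : D.Node} {T : ℕ}
    (h : ai C v T = ai D v' T) (hn : ai C v T ≠ none) {t : ℕ} (w : C.Node) (w' : D.Node)
    (hw : w.1 = w'.1) (hC : t + C.d w v ≤ T) (hD : t + D.d w' v' ≤ T) :
    st A C t w = st A D t w' := by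
  -- If the boundary conditions differ, the position is known to neither observer; lying in both
  -- cones, it must then be unreached, hence quiescent, in both runs.
  by_cases hb : bc C.carrier w.1 = bc D.carrier w.1
  · induction t generalizing w w' with
    | zero =>
      by_cases h0 : w = C.gen
      · have h0' : w' = D.gen := Subtype.ext (by rw [← hw, h0]; rfl)
        subst h0
        simp only [st, if_pos h0', if_true]
        exact congrArg _ hb
      · have h0' : w' ≠ D.gen := fun hc => h0 (Subtype.ext (by rw [hw, hc]; rfl))
        simp [st, h0, h0']
    | succ t ih =>
      -- A node reached in either run is known to the observer, so its boundary conditions agree and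
      -- the induction hypothesis applies; otherwise both states are quiescent.
      have key : ∀ (x : C.Node) (x' : D.Node), x.1 = x'.1 → t + C.d x v ≤ T →
          t + D.d x' v' ≤ T → st A C t x = st A D t x' := by
        intro x x' hx h1 h2
        by_cases hc : C.d C.gen x ≤ t
        · exact ih x x' hx h1 h2 (mem_and_bc_eq_of_ai_eq h hn (by omega)).2
        by_cases hd : D.d D.gen x' ≤ t
        · refine ih x x' hx h1 h2 ?_
          rw [hx]
          exact (mem_and_bc_eq_of_ai_eq h.symm (h ▸ hn) (by omega)).2.symm
        rw [st_eq_quiescent A C (by omega), st_eq_quiescent A D (by omega)]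
      rw [st_succ, st_succ, key w w' hw (by omega) (by omega)]
      congr 1
      funext i
      have hi := mem_iff_of_bc_eq hb (grid_adj_add w.1 i)
      unfold pull
      by_cases hc : w.1 + dir i ∈ C.carrier
      · have hd : w'.1 + dir i ∈ D.carrier := hw ▸ hi.1 hc
        rw [dif_pos hc, dif_pos hd]
        have h1 := dist_add_dir_le w v i hc
        have h2 := dist_add_dir_le w' v' i hd
        exact congrArg some (key _ _ (by simp [hw]) (by omega) (by omega))
      · have hd : w'.1 + dir i ∉ D.carrier := fun hd => hc (hi.2 (hw ▸ hd))
        rw [dif_neg hc, dif_neg hd]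
  · have hc : t < C.d C.gen w := by
      by_contra! hc
      exact hb (mem_and_bc_eq_of_ai_eq h hn (by omega)).2
    have hd : t < D.d D.gen w' := by
      by_contra! hd
      refine hb ?_
      rw [hw]
      exact (mem_and_bc_eq_of_ai_eq h.symm (h ▸ hn) (by omega)).2.symm
    rw [st_eq_quiescent A C hc, st_eq_quiescent A D hd]

/-- The common node has the same history up to `T` in both runs, so its first firing time is the
same; a solution fires all nodes together. -/
theorem FiresAt.of_step {A : Automaton} (hA : IsSolution A) {C D : Config} {T : ℕ}
    (hC : FiresAt A C T) (h : Step T C D) : FiresAt A D T := by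
  obtain ⟨v, hvC, hvD, hai, hn⟩ := h
  obtain ⟨t, ht⟩ := hA.2 D
  have key : ∀ t' ≤ T, st A C t' ⟨v, hvC⟩ = st A D t' ⟨v, hvD⟩ := fun t' ht' =>
    st_eq_of_ai_eq A hai hn _ _ rfl (by simpa [Config.d] using ht') (by simpa [Config.d] using ht')
  have h1 := hC ⟨v, hvC⟩
  have h2 := ht ⟨v, hvD⟩
  rcases lt_trichotomy t T with hlt | rfl | hlt
  · exact absurd (key t hlt.le ▸ h2.2) (h1.1 t hlt)
  · exact ht
  · exact absurd (key T le_rfl ▸ h1.2) (h2.1 T hlt)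

theorem FiresAt.of_equivalent {A : Automaton} (hA : IsSolution A) {C D : Config} {T : ℕ}
    (hC : FiresAt A C T) (h : Equivalent T C D) : FiresAt A D T := by
  induction h with
  | refl => exact hC
  | tail _ h ih => exact ih.of_step hA h

/-! ### Finiteness -/

/-- A function changing by at most one along edges bounds distance from below. It is applied to the
two grid coordinates and to the index along a path. -/
theorem abs_sub_le_dist {V : Type*} {G : SimpleGraph V} (hG : G.Connected) (f : V → ℤ)
    (hf : ∀ v w, G.Adj v w → |f v - f w| ≤ 1) (v w : V) : |f v - f w| ≤ G.dist v w := by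
  obtain ⟨p, hp⟩ := hG.exists_walk_length_eq_dist v w
  rw [← hp]
  clear hp
  induction p with
  | nil => simp
  | cons h p ih =>
    have := hf _ _ h
    rw [abs_le] at *
    push_cast [SimpleGraph.Walk.length_cons]
    constructor <;> linarith [this.1, this.2, ih.1, ih.2]

/-- Each such carrier is a subset of the square of side `2 * T` about the origin, and the carrier
determines the configuration. -/
theorem finite_setOf_dist_gen_le (T : ℕ) : {D : Config | ∀ v, D.d D.gen v ≤ T}.Finite := by
  have hfin : (Set.Icc (-(T : ℤ)) T ×ˢ Set.Icc (-(T : ℤ)) T).Finite :=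
    (Set.finite_Icc _ _).prod (Set.finite_Icc _ _)
  refine Set.Finite.of_finite_image (f := Config.carrier) (hfin.finite_subsets.subset ?_)
    fun _ _ _ _ h => Config.ext' h
  rintro _ ⟨D, hD, rfl⟩ v hv
  have hd : (D.d D.gen ⟨v, hv⟩ : ℤ) ≤ T := by exact_mod_cast hD ⟨v, hv⟩
  have h1 := abs_sub_le_dist D.connected (fun w => w.1.1) (by
    rintro ⟨p, hp⟩ ⟨q, hq⟩ ⟨i, hi⟩
    change q = p + dir i at hi
    subst hi
    fin_cases i <;> simp [dir]) D.gen ⟨v, hv⟩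
  have h2 := abs_sub_le_dist D.connected (fun w => w.1.2) (by
    rintro ⟨p, hp⟩ ⟨q, hq⟩ ⟨i, hi⟩
    change q = p + dir i at hi
    subst hi
    fin_cases i <;> simp [dir]) D.gen ⟨v, hv⟩
  have h1' := abs_le.1 (h1.trans hd)
  have h2' := abs_le.1 (h2.trans hd)
  simp only [Config.gen, Prod.fst_zero, Prod.snd_zero] at h1' h2'
  exact ⟨⟨by linarith, by linarith⟩, ⟨by linarith, by linarith⟩⟩

/-! ### Paths -/

namespace PathRep

variable {D E : Config}

theorem p_mem (ρ : PathRep D) {i : ℤ} (h1 : ρ.r ≤ i) (h2 : i ≤ ρ.s) : ρ.p i ∈ D.carrier := by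
  rw [ρ.carrier_eq]
  exact ⟨i, ⟨h1, h2⟩, rfl⟩

theorem exists_index (ρ : PathRep D) (v : D.Node) : ∃ i, ρ.r ≤ i ∧ i ≤ ρ.s ∧ ρ.p i = v.1 := by
  have hv : v.1 ∈ ρ.p '' Set.Icc ρ.r ρ.s := by
    rw [← ρ.carrier_eq]
    exact v.2
  obtain ⟨i, hi, h⟩ := hv
  exact ⟨i, hi.1, hi.2, h⟩

theorem eq_of_adj (ρ : PathRep D) {k : ℤ} (h1 : ρ.r ≤ k) (h2 : k ≤ ρ.s) {q : Pos}
    (hq : q ∈ D.carrier) (h : grid.Adj (ρ.p k) q) :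
    (k + 1 ≤ ρ.s ∧ q = ρ.p (k + 1)) ∨ (ρ.r ≤ k - 1 ∧ q = ρ.p (k - 1)) := by
  obtain ⟨i, hi1, hi2, rfl⟩ := ρ.exists_index ⟨q, hq⟩
  have n1 : ¬ k + 2 ≤ i := fun hc => ρ.not_adj k i h1 hc hi2 h
  have n2 : ¬ i + 2 ≤ k := fun hc => ρ.not_adj i k hi1 hc h2 h.symm
  have n3 : i ≠ k := by rintro rfl; exact h.ne rfl
  rcases (by omega : i = k + 1 ∨ i = k - 1) with rfl | rfl
  · exact Or.inl ⟨hi2, rfl⟩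
  · exact Or.inr ⟨hi1, rfl⟩

theorem dist_eq (ρ : PathRep D) {v w : D.Node} {i j : ℤ} (hi : ρ.r ≤ i ∧ i ≤ ρ.s)
    (hj : ρ.r ≤ j ∧ j ≤ ρ.s) (hv : ρ.p i = v.1) (hw : ρ.p j = w.1) : (D.d v w : ℤ) = |i - j| := by
  have up : ∀ (n : ℕ) (i : ℤ) (v w : D.Node), ρ.r ≤ i → i + n ≤ ρ.s → ρ.p i = v.1 →
      ρ.p (i + n) = w.1 → D.d v w ≤ n := by
    intro n
    induction n with
    | zero =>
      intro i v w _ _ hv hw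
      have : v = w := Subtype.ext (by rw [← hv, ← hw]; simp)
      simp [this, Config.d]
    | succ n ih =>
      intro i v w h1 h2 hv hw
      push_cast at h2 hw
      have h := ih i v ⟨_, ρ.p_mem (i := i + n) (by omega) (by omega)⟩ h1 (by omega) hv rfl
      have hadj : (grid.induce D.carrier).Adj
          ⟨_, ρ.p_mem (i := i + n) (by omega) (by omega)⟩ w := by
        change grid.Adj (ρ.p (i + n)) w.1
        rw [← hw, ← add_assoc]
        exact ρ.adj _ (by omega) (by omega)
      have h1 := SimpleGraph.dist_eq_one_iff_adj.2 hadj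
      have := D.connected.dist_triangle (u := v)
        (v := ⟨_, ρ.p_mem (i := i + n) (by omega) (by omega)⟩) (w := w)
      unfold Config.d at *
      omega
  apply le_antisymm
  · rcases le_total i j with hij | hij
    · have := up (j - i).toNat i v w hi.1 (by omega) hv (by rw [← hw]; congr 1; omega)
      rw [abs_of_nonpos (by omega)]
      omega
    · have := up (i - j).toNat j w v hj.1 (by omega) hw (by rw [← hv]; congr 1; omega)
      rw [abs_of_nonneg (by omega), Config.d, SimpleGraph.dist_comm, ← Config.d]
      omega
  -- Lower bound: a simple path has no chords, so the index of a node changes by one along every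
  -- edge.
  · choose f hf using ρ.exists_index
    have hfv : ∀ (k : ℤ) (x : D.Node), ρ.r ≤ k ∧ k ≤ ρ.s → ρ.p k = x.1 → f x = k :=
      fun k x hk hx => ρ.inj ⟨(hf x).1, (hf x).2.1⟩ hk ((hf x).2.2.trans hx.symm)
    have := abs_sub_le_dist D.connected f (by
      intro x y hxy
      have hxy' : grid.Adj (ρ.p (f x)) y.1 := by rw [(hf x).2.2]; exact hxy
      rcases ρ.eq_of_adj (hf x).1 (hf x).2.1 y.2 hxy' with ⟨h, e⟩ | ⟨h, e⟩
      · rw [hfv (f x + 1) y ⟨by linarith [(hf x).1], h⟩ e.symm]; simp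
      · rw [hfv (f x - 1) y ⟨h, by linarith [(hf x).2.1]⟩ e.symm]; simp) v w
    rwa [hfv i v hi hv, hfv j w hj hw] at this

/-- The nodes known at `p u` at time `T` are those of the part `p a, …, p b`. -/
theorem ai_eq (ρ : PathRep D) (T : ℕ) {u : ℤ} (h1 : ρ.r ≤ u) (h2 : u ≤ ρ.s)
    (hu : |u| ≤ T) (v : D.Node) (hv : ρ.p u = v.1) :
    ai D v T = some (T, ρ.p u,
      (fun i => (ρ.p i, bc D.carrier (ρ.p i))) '' Set.Icc (ρ.a T u) (ρ.b T u)) := by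
  have h0 : ρ.r ≤ 0 ∧ 0 ≤ ρ.s := ⟨ρ.r_nonpos, ρ.s_nonneg⟩
  have hg : ρ.p 0 = D.gen.1 := ρ.p_zero
  have hu' := abs_le.1 hu
  have hd := ρ.dist_eq h0 ⟨h1, h2⟩ hg hv
  rw [zero_sub, abs_neg] at hd
  rw [ai, if_pos (by omega), hv]
  congr 3
  ext x
  constructor
  · rintro ⟨w, hw, rfl⟩
    obtain ⟨i, hi1, hi2, hi⟩ := ρ.exists_index w
    have e1 := ρ.dist_eq h0 ⟨hi1, hi2⟩ hg hi
    have e2 := ρ.dist_eq ⟨hi1, hi2⟩ ⟨h1, h2⟩ hi hv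
    refine ⟨i, ⟨?_, ?_⟩, by simp only [hi]⟩
    -- The condition is `|i| + |i - u| ≤ T`. Given `|u| ≤ T`, it says that `2 * i` lies between `u -
    -- T` and `u + T`.
    · unfold PathRep.a
      have := neg_le_abs (0 - i); have := le_abs_self (0 - i)
      have := neg_le_abs (i - u); have := le_abs_self (i - u)
      omega
    · unfold PathRep.b
      have := neg_le_abs (0 - i); have := le_abs_self (0 - i)
      have := neg_le_abs (i - u); have := le_abs_self (i - u)
      omega
  · rintro ⟨i, ⟨ha, hb⟩, rfl⟩
    unfold PathRep.a at ha
    unfold PathRep.b at hb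
    have hi : ρ.r ≤ i ∧ i ≤ ρ.s := ⟨by omega, by omega⟩
    refine ⟨⟨ρ.p i, ρ.p_mem hi.1 hi.2⟩, ?_, rfl⟩
    have e1 := ρ.dist_eq h0 hi hg (w := ⟨ρ.p i, ρ.p_mem hi.1 hi.2⟩) rfl
    have e2 := ρ.dist_eq hi ⟨h1, h2⟩ (v := ⟨ρ.p i, ρ.p_mem hi.1 hi.2⟩) rfl hv
    rcases abs_cases (0 - i) with h3 | h3 <;> rcases abs_cases (i - u) with h4 | h4 <;> omega

/-- The same path in the opposite orientation. -/
def flip (ρ : PathRep D) : PathRep D where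
  r := -ρ.s
  s := -ρ.r
  p i := ρ.p (-i)
  r_nonpos := by have := ρ.s_nonneg; omega
  s_nonneg := by have := ρ.r_nonpos; omega
  p_zero := by simpa using ρ.p_zero
  carrier_eq := by
    rw [ρ.carrier_eq]
    ext v
    constructor
    · rintro ⟨i, ⟨h1, h2⟩, rfl⟩
      exact ⟨-i, ⟨by omega, by omega⟩, by simp⟩
    · rintro ⟨i, ⟨h1, h2⟩, rfl⟩
      exact ⟨-i, ⟨by omega, by omega⟩, rfl⟩
  adj k h1 h2 := by
    have := (ρ.adj (-(k + 1)) (by omega) (by omega)).symm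
    rwa [show -(k + 1) + 1 = -k by ring] at this
  inj i hi j hj h := by
    have hi' : -i ∈ Set.Icc ρ.r ρ.s := ⟨by have := hi.2; omega, by have := hi.1; omega⟩
    have hj' : -j ∈ Set.Icc ρ.r ρ.s := ⟨by have := hj.2; omega, by have := hj.1; omega⟩
    exact neg_injective (ρ.inj hi' hj' h)
  not_adj i j h1 h2 h3 h := ρ.not_adj (-j) (-i) (by omega) (by omega) (by omega) h.symm

/-- Once the first step is fixed the path is forced: the next position is a neighbour in `E`, hence
the successor or the predecessor along `σ`, and the predecessor is already used in `ρ`. -/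
theorem agree_right (ρ : PathRep D) (σ : PathRep E) {b : ℤ} (hb : b ≤ ρ.s)
    (hmem : ∀ i, 0 ≤ i → i ≤ b → ρ.p i ∈ E.carrier)
    (hone : 1 ≤ b → 1 ≤ σ.s ∧ σ.p 1 = ρ.p 1) (n : ℕ) (hn : n ≤ b) :
    n ≤ σ.s ∧ σ.p n = ρ.p n := by
  have hr := ρ.r_nonpos
  have hr' := σ.r_nonpos
  induction n using Nat.strong_induction_on with
  | _ n ih =>
    match n with
    | 0 => exact ⟨σ.s_nonneg, by simp [σ.p_zero, ρ.p_zero]⟩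
    | 1 => simpa using hone (by simpa using hn)
    | n + 2 =>
      push_cast at hn ⊢
      obtain ⟨h1, e1⟩ := ih (n + 1) (by omega) (by push_cast; omega)
      obtain ⟨h2, e2⟩ := ih n (by omega) (by omega)
      push_cast at h1 e1
      have hadj := ρ.adj (n + 1) (by omega) (by omega)
      rw [← e1, show (n : ℤ) + 1 + 1 = n + 2 by ring] at hadj
      rcases σ.eq_of_adj (by omega) h1 (hmem (n + 2) (by omega) hn) hadj with ⟨h, e⟩ | ⟨h, e⟩
      · rw [show (n : ℤ) + 1 + 1 = n + 2 by ring] at h e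
        exact ⟨h, e.symm⟩
      · rw [show (n : ℤ) + 1 - 1 = n by ring, e2] at e
        have := ρ.inj ⟨by omega, by omega⟩ ⟨by omega, by omega⟩ e
        omega

/-- The origin has at most two neighbours in `E`, so flipping a representation of `E` if necessary
aligns the first step on one side; injectivity then aligns the other side. -/
theorem exists_agree (ρ : PathRep D) {a b : ℤ} (ha : a ≤ 0) (hb : 0 ≤ b) (har : ρ.r ≤ a)
    (hbs : b ≤ ρ.s) (hmem : ∀ i, a ≤ i → i ≤ b → ρ.p i ∈ E.carrier) :
    ∃ σ : PathRep E, ∀ i, a ≤ i → i ≤ b → σ.r ≤ i ∧ i ≤ σ.s ∧ σ.p i = ρ.p i := by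
  have hone : ∀ σ : PathRep E, 1 ≤ b → (1 ≤ σ.s ∧ ρ.p 1 = σ.p 1) ∨ (σ.r ≤ -1 ∧ ρ.p 1 = σ.p (-1)) := by
    intro σ h
    have hadj := ρ.adj 0 (by omega) (by omega)
    rw [ρ.p_zero, ← σ.p_zero] at hadj
    simpa using σ.eq_of_adj σ.r_nonpos σ.s_nonneg (hmem 1 (by omega) h) hadj
  have hneg : ∀ σ : PathRep E, a ≤ -1 →
      (1 ≤ σ.s ∧ ρ.p (-1) = σ.p 1) ∨ (σ.r ≤ -1 ∧ ρ.p (-1) = σ.p (-1)) := by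
    intro σ h
    have hadj := (ρ.adj (-1) (by omega) (by omega)).symm
    rw [show (-1 : ℤ) + 1 = 0 by ring, ρ.p_zero, ← σ.p_zero] at hadj
    simpa using σ.eq_of_adj σ.r_nonpos σ.s_nonneg (hmem (-1) h (by omega)) hadj
  obtain ⟨σ, hσ1, hσ2⟩ : ∃ σ : PathRep E, (1 ≤ b → 1 ≤ σ.s ∧ σ.p 1 = ρ.p 1) ∧
      (a ≤ -1 → σ.r ≤ -1 ∧ σ.p (-1) = ρ.p (-1)) := by
    obtain ⟨σ⟩ := PathRep.nonempty E
    by_cases h1 : 1 ≤ b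
    · obtain ⟨σ, hs, he⟩ : ∃ σ : PathRep E, 1 ≤ σ.s ∧ ρ.p 1 = σ.p 1 := by
        rcases hone σ h1 with h | h
        · exact ⟨σ, h⟩
        · exact ⟨σ.flip, by change 1 ≤ -σ.r; omega, h.2⟩
      refine ⟨σ, fun _ => ⟨hs, he.symm⟩, fun h2 => ?_⟩
      rcases hneg σ h2 with h | h
      · have := ρ.inj ⟨by omega, by omega⟩ ⟨by omega, by omega⟩ (h.2.trans he.symm)
        omega
      · exact ⟨h.1, h.2.symm⟩
    · by_cases h2 : a ≤ -1
      · rcases hneg σ h2 with h | h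
        · exact ⟨σ.flip, fun h3 => absurd h3 h1, fun _ => ⟨by change -σ.s ≤ -1; omega,
            by change σ.p (- -1) = _; rw [neg_neg]; exact h.2.symm⟩⟩
        · exact ⟨σ, fun h3 => absurd h3 h1, fun _ => ⟨h.1, h.2.symm⟩⟩
      · exact ⟨σ, fun h3 => absurd h3 h1, fun h3 => absurd h3 h2⟩
  refine ⟨σ, fun i hi1 hi2 => ?_⟩
  have hr := σ.r_nonpos
  have hs := σ.s_nonneg
  rcases le_total 0 i with h0 | h0
  · lift i to ℕ using h0
    have := ρ.agree_right σ hbs (fun j h1 h2 => hmem j (by omega) h2) hσ1 i hi2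
    exact ⟨by omega, this⟩
  · obtain ⟨n, rfl⟩ : ∃ n : ℕ, i = -n := ⟨i.natAbs, by omega⟩
    have := ρ.flip.agree_right σ.flip (b := -a) (by change -a ≤ -ρ.r; omega)
      (fun j h1 h2 => hmem (-j) (by omega) (by omega))
      (fun h => ⟨by change 1 ≤ -σ.r; have := hσ2 (by omega); omega, (hσ2 (by omega)).2⟩) n (by omega)
    obtain ⟨h3, h4⟩ := this
    change (n : ℤ) ≤ -σ.r at h3
    exact ⟨by omega, by omega, h4⟩

/-- If `p a, …, p b` are nodes of `E` with the same boundary conditions then the node `p u` has the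
same available information in both configurations. -/
theorem step_of_bc_eq (ρ : PathRep D) {T : ℕ} {u : ℤ} (h1 : ρ.r ≤ u) (h2 : u ≤ ρ.s)
    (hu : |u| ≤ T) (h : ∀ i, ρ.a T u ≤ i → i ≤ ρ.b T u →
      ρ.p i ∈ E.carrier ∧ bc E.carrier (ρ.p i) = bc D.carrier (ρ.p i)) : Step T D E := by
  have hu' := abs_le.1 hu
  have hr := ρ.r_nonpos
  have hs := ρ.s_nonneg
  have hau : ρ.a T u ≤ u := by unfold PathRep.a; omega
  have hub : u ≤ ρ.b T u := by unfold PathRep.b; omega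
  have ha0 : ρ.a T u ≤ 0 := by unfold PathRep.a; omega
  have hb0 : 0 ≤ ρ.b T u := by unfold PathRep.b; omega
  obtain ⟨σ, hσ⟩ := ρ.exists_agree ha0 hb0 (le_max_left _ _) (min_le_left _ _)
    fun i hi1 hi2 => (h i hi1 hi2).1
  have hau' := hσ _ le_rfl (hau.trans hub)
  have hbu' := hσ _ (hau.trans hub) le_rfl
  -- If the time bound determines `a`, it does so for `σ` too. Otherwise `a` is the end `ρ.r`, and
  -- `σ` must end there as well: a further node of `E` next to `p r` would, by the boundary
  -- condition, be in `D`, hence equal to `p (r + 1)`.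
  have ea : σ.a T u = ρ.a T u := by
    by_cases hc : ρ.r ≤ -((T - u) / 2)
    · unfold PathRep.a at *; omega
    have ear : ρ.a T u = ρ.r := by unfold PathRep.a; omega
    suffices σ.r = ρ.r by unfold PathRep.a; rw [this]
    rw [ear] at hau'
    by_contra hne
    have hadj := (σ.adj (ρ.r - 1) (by omega) (by omega)).symm
    rw [sub_add_cancel] at hadj
    have hm := (mem_iff_of_bc_eq (h ρ.r (by omega) (by omega)).2 (hau'.2.2 ▸ hadj)).1
      (σ.p_mem (by omega) (by omega))
    rcases ρ.eq_of_adj le_rfl (by omega) hm (hau'.2.2 ▸ hadj) with ⟨h3, h4⟩ | ⟨h3, h4⟩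
    -- The strict inequality in the negation of `hc` makes `p (r + 1)` part of the known segment,
    -- where `σ` and `ρ` agree; so `σ` would repeat a position.
    · have hb1 : ρ.r + 1 ≤ ρ.b T u := by unfold PathRep.b at *; omega
      have := hσ (ρ.r + 1) (by omega) hb1
      rw [← this.2.2] at h4
      have := σ.inj ⟨by omega, by omega⟩ ⟨by omega, by omega⟩ h4
      omega
    · omega
  have eb : σ.b T u = ρ.b T u := by
    by_cases hc : (u + T) / 2 ≤ ρ.s
    · unfold PathRep.b at *; omega
    have ebs : ρ.b T u = ρ.s := by unfold PathRep.b; omega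
    suffices σ.s = ρ.s by unfold PathRep.b; rw [this]
    rw [ebs] at hbu'
    by_contra hne
    have hadj := σ.adj ρ.s (by omega) (by omega)
    have hm := (mem_iff_of_bc_eq (h ρ.s (by omega) (by omega)).2 (hbu'.2.2 ▸ hadj)).1
      (σ.p_mem (by omega) (by omega))
    rcases ρ.eq_of_adj (by omega) le_rfl hm (hbu'.2.2 ▸ hadj) with ⟨h3, h4⟩ | ⟨h3, h4⟩
    · omega
    · have ha1 : ρ.a T u ≤ ρ.s - 1 := by unfold PathRep.a at *; omega
      have := hσ (ρ.s - 1) ha1 (by omega)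
      rw [← this.2.2] at h4
      have := σ.inj ⟨by omega, by omega⟩ ⟨by omega, by omega⟩ h4
      omega
  have hu3 := hσ u hau hub
  have e1 := ρ.ai_eq T h1 h2 hu ⟨ρ.p u, ρ.p_mem h1 h2⟩ rfl
  have e2 := σ.ai_eq T hu3.1 hu3.2.1 hu ⟨ρ.p u, (h u hau hub).1⟩ hu3.2.2
  refine ⟨ρ.p u, ρ.p_mem h1 h2, (h u hau hub).1, ?_, by rw [e1]; simp⟩
  rw [e1, e2, ea, eb, hu3.2.2]
  congr 3
  refine Set.image_congr fun i hi => ?_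
  rw [(hσ i hi.1 hi.2).2.2, (h i hi.1 hi.2).2]

end PathRep


/-! ### Signals -/

/-- The bits `B t v` run as prescribed for the signals on `q 0, …, q l` up to time `T`. -/
structure IsSignalRun (T : ℕ) (D : Config) (q : ℕ → Pos) (l : ℕ) {E : Config}
    (B : ℕ → E.Node → Bool) : Prop where
  zero : ∀ v, B 0 v = true ↔ v = E.gen ∧ bc E.carrier 0 = bc D.carrier 0
  succ : ∀ t < T, ∀ v, B (t + 1) v = true ↔ SignalNext D q l t (B t v) (pull (B t) v)

namespace IsSignalRun

variable {T l : ℕ} {D E : Config} {q : ℕ → Pos} {B : ℕ → E.Node → Bool}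

/-- Every set bit descends from the general through successful checks. Before time `l` it can sit
only at `q t`; later it may be anywhere, but still certifies the whole part. -/
theorem sound (h : IsSignalRun T D q l B) (hq : q 0 = 0) {t : ℕ} (ht : t ≤ T) {v : E.Node}
    (hv : B t v = true) : (t ≤ l → v.1 = q t) ∧
      ∀ j ≤ l, j ≤ t → q j ∈ E.carrier ∧ bc E.carrier (q j) = bc D.carrier (q j) := by
  induction t generalizing v with
  | zero =>
    obtain ⟨rfl, hb⟩ := (h.zero v).1 hv
    refine ⟨fun _ => hq.symm, fun j _ hj => ?_⟩
    obtain rfl : j = 0 := by omega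
    rw [hq]
    exact ⟨E.gen.2, hb⟩
  | succ t ih =>
    have hn := (h.succ t (by omega) v).1 hv
    unfold SignalNext at hn
    split at hn
    · obtain ⟨⟨i, hi, hp⟩, hb⟩ := hn
      obtain ⟨hm, hp⟩ := pull_eq_some.1 hp
      obtain ⟨h1, h2⟩ := ih (by omega) hp
      -- The signal is accepted only from the direction leading from `q (t + 1)` back to `q t`,
      -- which identifies the position of the receiver.
      have hv' : v.1 = q (t + 1) := add_right_cancel ((h1 (by omega)).trans hi.symm)
      refine ⟨fun _ => hv', fun j hj hjt => ?_⟩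
      rcases Nat.lt_or_ge j (t + 1) with hlt | hge
      · exact h2 j hj (by omega)
      · obtain rfl : j = t + 1 := by omega
        rw [isSome_pull, hv'] at hb
        exact ⟨hv' ▸ v.2, hb⟩
    · refine ⟨fun _ => by omega, fun j hj _ => ?_⟩
      rcases hn with hn | ⟨i, hp⟩
      · exact (ih (by omega) hn).2 j hj (by omega)
      · obtain ⟨hm, hp⟩ := pull_eq_some.1 hp
        exact (ih (by omega) hp).2 j hj (by omega)

theorem spread (h : IsSignalRun T D q l B) {t : ℕ} (hl : l ≤ t) {v w : E.Node}
    (hv : B t v = true) (ht : t + E.d v w ≤ T) : B T w = true := by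
  have stay : ∀ n t, l ≤ t → t + n ≤ T → ∀ v, B t v = true → B (t + n) v = true := by
    intro n
    induction n with
    | zero => exact fun _ _ _ _ h => h
    | succ n ih =>
      intro t hl ht v hv
      refine (h.succ (t + n) (by omega) v).2 ?_
      rw [SignalNext, if_neg (by omega)]
      exact Or.inl (ih t hl (by omega) v hv)
  obtain ⟨p, hp⟩ := E.connected.exists_walk_length_eq_dist v w
  rw [Config.d, ← hp] at ht
  clear hp
  induction p generalizing t with
  | nil =>
    obtain ⟨n, rfl⟩ := Nat.exists_eq_add_of_le ht
    exact stay n _ hl (by simp) _ hv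
  | @cons x y z hadj p ih =>
    rw [SimpleGraph.Walk.length_cons] at ht
    refine ih (t := t + 1) (by omega) ((h.succ t (by omega) y).2 ?_) (by omega)
    rw [SignalNext, if_neg (by omega)]
    have hyx : grid.Adj y.1 x.1 := SimpleGraph.Adj.symm hadj
    obtain ⟨i, hi⟩ := hyx
    refine Or.inr ⟨i, pull_eq_some.2 ⟨hi ▸ x.2, ?_⟩⟩
    rw [← hv]
    exact congrArg _ (Subtype.ext hi.symm)

theorem complete {B : ℕ → D.Node → Bool} (h : IsSignalRun T D q l B) (hq : q 0 = 0)
    (hmem : ∀ j ≤ l, q j ∈ D.carrier) (hadj : ∀ j < l, grid.Adj (q j) (q (j + 1)))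
    {w : D.Node} (hT : l + D.d ⟨q l, hmem l le_rfl⟩ w ≤ T) : B T w = true := by
  have run : ∀ t (ht : t ≤ l), B t ⟨q t, hmem t ht⟩ = true := by
    intro t
    induction t with
    | zero => exact fun _ => (h.zero _).2 ⟨Subtype.ext hq, rfl⟩
    | succ t ih =>
      intro ht
      refine (h.succ t (by omega) _).2 ?_
      rw [SignalNext, if_pos ht, isSome_pull]
      obtain ⟨i, hi⟩ := (hadj t ht).symm
      refine ⟨⟨i, hi.symm, pull_eq_some.2 ⟨hi ▸ hmem t (by omega), ?_⟩⟩, rfl⟩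
      rw [← ih (by omega)]
      exact congrArg _ (Subtype.ext hi.symm)
  exact h.spread le_rfl (run l le_rfl) hT

end IsSignalRun

/-! ### The automata `A₀` -/

/-- When all visible clocks agree, the arbitrary choice in `readTime` is harmless. -/
theorem readTime_eq_some_iff {T t : ℕ} {own : Clock T} {inp : Fin 4 → Option (Clock T)}
    (h : ∀ m, ReadsClock own inp m → (m : ℕ) = t) {n : Fin T} :
    readTime own inp = some n ↔ (n : ℕ) = t ∧ ReadsClock own inp n.castSucc := by
  unfold readTime
  split
  next hex =>
    have hc := hex.choose_spec
    have := h _ hc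
    rw [Fin.val_castSucc] at this
    constructor
    · intro he
      rw [Option.some.injEq] at he
      exact he ▸ ⟨this, hc⟩
    · rintro ⟨hn, -⟩
      exact congrArg some (Fin.ext (this.trans hn.symm))
  next hex =>
    refine ⟨fun h => by simp at h, fun hn => absurd ⟨n, hn.2⟩ hex⟩

section A0

variable {T : ℕ} {D : Config} (ρ : PathRep D) (u : ℤ) (E : Config)

/-- The state of `v` at time `t` in a run of `A₀(u, D)` on `E`. -/
noncomputable def stA0 (T : ℕ) (t : ℕ) (v : E.Node) : (Bool × Bool) × Clock T :=
  st (A0 T ρ u) E t v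

open Classical in
theorem stA0_zero (v : E.Node) : stA0 ρ u E T 0 v = if v = E.gen then
    ((decide (bc E.carrier 0 = bc D.carrier 0), decide (bc E.carrier 0 = bc D.carrier 0)), some 0)
    else ((false, false), none) := rfl

/-- The time read by `v` at time `t`. -/
noncomputable def clockRead (t : ℕ) (v : E.Node) : Option (Fin T) :=
  readTime (stA0 ρ u E T t v).2 (pull (fun w => (stA0 ρ u E T t w).2) v)

open Classical in
theorem A0_next_pull (f : E.Node → (Bool × Bool) × Clock T) (v : E.Node) :
    (A0 T ρ u).next (f v) (pull f v) =
      match readTime (f v).2 (pull (fun w => (f w).2) v) with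
      | none => ((false, false), none)
      | some t =>
        ((decide (SignalNext D (fun j => ρ.p (-(j : ℤ))) (-(ρ.a T u)).toNat t (f v).1.1
            (pull (fun w => (f w).1.1) v)),
          decide (SignalNext D (fun j => ρ.p j) (ρ.b T u).toNat t (f v).1.2
            (pull (fun w => (f w).1.2) v))),
          some t.succ) := by
  change (match readTime (f v).2 (fun i => (pull f v i).map Prod.snd) with
      | none => ((false, false), none)
      | some t =>
        ((decide (SignalNext D (fun j => ρ.p (-(j : ℤ))) (-(ρ.a T u)).toNat t (f v).1.1
            (fun i => (pull f v i).map fun y : (Bool × Bool) × Clock T => y.1.1)),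
          decide (SignalNext D (fun j => ρ.p j) (ρ.b T u).toNat t (f v).1.2
            (fun i => (pull f v i).map fun y : (Bool × Bool) × Clock T => y.1.2))),
          some t.succ)) = _
  simp only [map_pull]
  rfl

theorem stA0_succ_of_none {t : ℕ} {v : E.Node} (h : clockRead (T := T) ρ u E t v = none) :
    stA0 ρ u E T (t + 1) v = ((false, false), none) := by
  unfold clockRead at h
  have := A0_next_pull ρ u E (stA0 ρ u E T t) v
  rw [h] at this
  exact this

open Classical in
theorem stA0_succ_of_some {t : ℕ} {v : E.Node} {n : Fin T} (h : clockRead ρ u E t v = some n) :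
    stA0 ρ u E T (t + 1) v =
      ((decide (SignalNext D (fun j => ρ.p (-(j : ℤ))) (-(ρ.a T u)).toNat n
          (stA0 ρ u E T t v).1.1 (pull (fun w => (stA0 ρ u E T t w).1.1) v)),
        decide (SignalNext D (fun j => ρ.p j) (ρ.b T u).toNat n
          (stA0 ρ u E T t v).1.2 (pull (fun w => (stA0 ρ u E T t w).1.2) v))),
        some n.succ) := by
  unfold clockRead at h
  have := A0_next_pull ρ u E (stA0 ρ u E T t) v
  rw [h] at this
  exact this

theorem clock_eq {t : ℕ} {v : E.Node} {m : Fin (T + 1)} (h : (stA0 ρ u E T t v).2 = some m) :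
    (m : ℕ) = t := by
  induction t generalizing v m with
  | zero =>
    by_cases hv : v = E.gen
    · simp only [stA0_zero, hv, if_true, Option.some.injEq] at h
      simp [← h]
    · simp [stA0_zero, hv] at h
  | succ t ih =>
    cases hr : clockRead (T := T) ρ u E t v with
    | none => rw [stA0_succ_of_none ρ u E hr] at h; simp at h
    | some n =>
      rw [stA0_succ_of_some ρ u E hr, Option.some.injEq] at h
      have := (readTime_eq_some_iff (t := t) (fun m hm => by
        rcases hm with hm | ⟨i, hi⟩
        · exact ih hm
        · obtain ⟨_, hi⟩ := pull_eq_some.1 hi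
          exact ih hi)).1 hr
      rw [← h, Fin.val_succ, this.1]

theorem clockRead_eq_some_iff {t : ℕ} {v : E.Node} {n : Fin T} :
    clockRead ρ u E t v = some n ↔ (n : ℕ) = t ∧ ReadsClock (stA0 ρ u E T t v).2
      (pull (fun w => (stA0 ρ u E T t w).2) v) n.castSucc :=
  readTime_eq_some_iff fun m hm => by
    rcases hm with hm | ⟨i, hi⟩
    · exact clock_eq ρ u E hm
    · obtain ⟨_, hi⟩ := pull_eq_some.1 hi
      exact clock_eq ρ u E hi

/-- A signal never outruns the clock, because the bits are cleared wherever no time is read. This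
lets `IsSignalRun` be stated without mentioning clocks. -/
theorem clock_of_signal {t : ℕ} {v : E.Node}
    (h : (stA0 ρ u E T t v).1.1 = true ∨ (stA0 ρ u E T t v).1.2 = true) (ht : t ≤ T) :
    (stA0 ρ u E T t v).2 = some ⟨t, by omega⟩ := by
  suffices ∃ m, (stA0 ρ u E T t v).2 = some m by
    obtain ⟨m, hm⟩ := this
    rw [hm, Option.some.injEq]
    exact Fin.ext (clock_eq ρ u E hm)
  cases t with
  | zero =>
    by_cases hv : v = E.gen
    · exact ⟨0, by simp [stA0_zero, hv]⟩
    · simp [stA0_zero, hv] at h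
  | succ t =>
    cases hr : clockRead (T := T) ρ u E t v with
    | none => rw [stA0_succ_of_none ρ u E hr] at h; simp at h
    | some n => exact ⟨_, by rw [stA0_succ_of_some ρ u E hr]⟩

theorem exists_signal_of_signalNext {q : ℕ → Pos} {l t : ℕ} {B : E.Node → Bool} {v : E.Node}
    (h : SignalNext D q l t (B v) (pull B v)) :
    B v = true ∨ ∃ (i : Fin 4) (hi : v.1 + dir i ∈ E.carrier), B ⟨v.1 + dir i, hi⟩ = true := by
  unfold SignalNext at h
  split at h
  · obtain ⟨⟨i, -, hi⟩, -⟩ := h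
    exact Or.inr ⟨i, pull_eq_some.1 hi⟩
  · exact h.imp_right fun ⟨i, hi⟩ => ⟨i, pull_eq_some.1 hi⟩

theorem clockRead_of_signal {t : ℕ} (ht : t < T) {v : E.Node}
    (h : ((stA0 ρ u E T t v).1.1 = true ∨ (stA0 ρ u E T t v).1.2 = true) ∨
      ∃ (i : Fin 4) (hi : v.1 + dir i ∈ E.carrier),
        (stA0 ρ u E T t ⟨v.1 + dir i, hi⟩).1.1 = true ∨
        (stA0 ρ u E T t ⟨v.1 + dir i, hi⟩).1.2 = true) :
    clockRead ρ u E t v = some ⟨t, ht⟩ := by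
  refine (clockRead_eq_some_iff ρ u E).2 ⟨rfl, ?_⟩
  rcases h with h | ⟨i, hi, h⟩
  · exact Or.inl (clock_of_signal ρ u E h ht.le)
  · exact Or.inr ⟨i, pull_eq_some.2 ⟨hi, clock_of_signal ρ u E h ht.le⟩⟩

theorem isSignalRun_left : IsSignalRun T D (fun j => ρ.p (-(j : ℤ))) (-(ρ.a T u)).toNat
    fun t v => (stA0 ρ u E T t v).1.1 where
  zero v := by
    by_cases hv : v = E.gen <;> simp [stA0_zero, hv]
  succ t ht v := by
    constructor
    · intro h
      cases hr : clockRead (T := T) ρ u E t v with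
      | none => rw [stA0_succ_of_none ρ u E hr] at h; simp at h
      | some n =>
        rw [stA0_succ_of_some ρ u E hr, ((clockRead_eq_some_iff ρ u E).1 hr).1] at h
        simpa using h
    · intro h
      have hr := clockRead_of_signal ρ u E ht ((exists_signal_of_signalNext E
        (B := fun w => (stA0 ρ u E T t w).1.1) h).imp Or.inl
          fun ⟨i, hi, h⟩ => ⟨i, hi, Or.inl h⟩)
      rw [stA0_succ_of_some ρ u E hr]
      simpa using h

theorem isSignalRun_right : IsSignalRun T D (fun j => ρ.p j) (ρ.b T u).toNat
    fun t v => (stA0 ρ u E T t v).1.2 where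
  zero v := by
    by_cases hv : v = E.gen <;> simp [stA0_zero, hv]
  succ t ht v := by
    constructor
    · intro h
      cases hr : clockRead (T := T) ρ u E t v with
      | none => rw [stA0_succ_of_none ρ u E hr] at h; simp at h
      | some n =>
        rw [stA0_succ_of_some ρ u E hr, ((clockRead_eq_some_iff ρ u E).1 hr).1] at h
        simpa using h
    · intro h
      have hr := clockRead_of_signal ρ u E ht ((exists_signal_of_signalNext E
        (B := fun w => (stA0 ρ u E T t w).1.2) h).imp Or.inr
          fun ⟨i, hi, h⟩ => ⟨i, hi, Or.inr h⟩)
      rw [stA0_succ_of_some ρ u E hr]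
      simpa using h

theorem eq_of_firing_A0 {t : ℕ} {v : E.Node} (h : st (A0 T ρ u) E t v ∈ (A0 T ρ u).firing) :
    t = T := by
  have h' : stA0 ρ u E T t v = ((true, true), some (Fin.last T)) := h
  exact (clock_eq ρ u E (congrArg Prod.snd h')).symm

variable {u}

/-- If a node of `E` fires then `E` is one step away from `D`. -/
theorem step_of_firing_A0 (h1 : ρ.r ≤ u) (h2 : u ≤ ρ.s) (hu : |u| ≤ T) {t : ℕ} {v : E.Node}
    (h : st (A0 T ρ u) E t v ∈ (A0 T ρ u).firing) : Step T D E := by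
  obtain rfl := eq_of_firing_A0 ρ u E h
  have h' : stA0 ρ u E t t v = ((true, true), some (Fin.last t)) := h
  have hu' := abs_le.1 hu
  have hr := ρ.r_nonpos
  have hs := ρ.s_nonneg
  have hl := ((isSignalRun_left ρ u E).sound (by simpa using ρ.p_zero) le_rfl (v := v)
    (by rw [h'])).2
  have hr := ((isSignalRun_right ρ u E).sound (by simpa using ρ.p_zero) le_rfl (v := v)
    (by rw [h'])).2
  refine ρ.step_of_bc_eq h1 h2 hu fun i hi1 hi2 => ?_
  rcases le_total 0 i with h0 | h0
  · lift i to ℕ using h0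
    exact hr i (by omega) (by unfold PathRep.b at hi2; omega)
  · obtain ⟨n, rfl⟩ : ∃ n : ℕ, i = -n := ⟨i.natAbs, by omega⟩
    exact hl n (by omega) (by unfold PathRep.a at hi1; omega)

theorem firing_A0 (h1 : ρ.r ≤ u) (h2 : u ≤ ρ.s) (hu : |u| ≤ T) (v : D.Node) (hv : ρ.p u = v.1) :
    st (A0 T ρ u) D T v ∈ (A0 T ρ u).firing := by
  have hu' := abs_le.1 hu
  have hr := ρ.r_nonpos
  have hs := ρ.s_nonneg
  -- The signal needs `-a` steps to reach `p a` and `u - a` more to come back to `p u`, in total `u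
  -- - 2 * a`; symmetrically `2 * b - u` on the right.
  have ha : ρ.r ≤ ρ.a T u ∧ ρ.a T u ≤ 0 ∧ ρ.a T u ≤ u ∧ u - 2 * ρ.a T u ≤ T := by
    unfold PathRep.a; omega
  have hb : ρ.b T u ≤ ρ.s ∧ 0 ≤ ρ.b T u ∧ u ≤ ρ.b T u ∧ 2 * ρ.b T u - u ≤ T := by
    unfold PathRep.b; omega
  have hl : (stA0 ρ u D T T v).1.1 = true := by
    refine (isSignalRun_left ρ u D).complete (by simpa using ρ.p_zero)
      (fun j hj => ρ.p_mem (by omega) (by omega)) (fun j hj => ?_) ?_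
    · have := (ρ.adj (-(j + 1 : ℕ) : ℤ) (by omega) (by omega)).symm
      rwa [show (-(j + 1 : ℕ) : ℤ) + 1 = -j by push_cast; ring] at this
    · have := ρ.dist_eq (i := -((-(ρ.a T u)).toNat : ℤ)) ⟨by omega, by omega⟩ ⟨h1, h2⟩
        (v := ⟨_, ρ.p_mem (by omega) (by omega)⟩) rfl hv
      rw [abs_of_nonpos (by omega)] at this
      omega
  have hr : (stA0 ρ u D T T v).1.2 = true := by
    refine (isSignalRun_right ρ u D).complete (by simpa using ρ.p_zero)
      (fun j hj => ρ.p_mem (by omega) (by omega)) (fun j hj => ?_) ?_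
    · exact_mod_cast ρ.adj j (by omega) (by omega)
    · have := ρ.dist_eq (i := ((ρ.b T u).toNat : ℤ)) ⟨by omega, by omega⟩ ⟨h1, h2⟩
        (v := ⟨_, ρ.p_mem (by omega) (by omega)⟩) rfl hv
      rw [abs_of_nonneg (by omega)] at this
      omega
  exact Prod.ext (Prod.ext hl hr) (clock_of_signal ρ u D (Or.inl hl) le_rfl)

end A0

/-! ### The automaton `Acc` -/

/-- The state of `v` at time `t` in a run of `Acc` on `E`. -/
noncomputable def stAcc (ρ : ∀ D : Config, PathRep D) (C : Config) (T : ℕ) (E : Config) (t : ℕ)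
    (v : E.Node) : (CCIndex ρ C T → Bool × Bool) × Clock T :=
  st (Acc ρ C T) E t v

theorem stAcc_succ (ρ : ∀ D : Config, PathRep D) (C : Config) (T : ℕ) (E : Config) (t : ℕ)
    (v : E.Node) : stAcc ρ C T E (t + 1) v =
      (fun x => ((A0 T (ρ x.1.1) x.2.1).next ((stAcc ρ C T E t v).1 x, (stAcc ρ C T E t v).2)
          (pull (fun w => ((stAcc ρ C T E t w).1 x, (stAcc ρ C T E t w).2)) v)).1,
        (readTime (stAcc ρ C T E t v).2 (pull (fun w => (stAcc ρ C T E t w).2) v)).map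
          Fin.succ) := by
  change (fun x => ((A0 T (ρ x.1.1) x.2.1).next ((stAcc ρ C T E t v).1 x, (stAcc ρ C T E t v).2)
          (fun i => (pull (stAcc ρ C T E t) v i).map fun z => (z.1 x, z.2))).1,
        (readTime (stAcc ρ C T E t v).2 (fun i => (pull (stAcc ρ C T E t) v i).map
          Prod.snd)).map Fin.succ) = _
  have h1 (x : CCIndex ρ C T) : (fun i => (pull (stAcc ρ C T E t) v i).map fun z => (z.1 x, z.2)) =
      pull (fun w => ((stAcc ρ C T E t w).1 x, (stAcc ρ C T E t w).2)) v :=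
    funext fun i => map_pull _ _ _ _
  have h2 : (fun i => (pull (stAcc ρ C T E t) v i).map Prod.snd) =
      pull (fun w => (stAcc ρ C T E t w).2) v := funext fun i => map_pull _ _ _ _
  rw [h2]
  exact Prod.ext (funext fun x =>
    congrArg (fun inp => ((A0 T (ρ x.1.1) x.2.1).next
      ((stAcc ρ C T E t v).1 x, (stAcc ρ C T E t v).2) inp).1) (h1 x)) rfl

/-- The clock update ignores the signal bits, so one shared clock serves all components and
projecting to a component commutes with the dynamics. -/
theorem stAcc_eq (ρ : ∀ D : Config, PathRep D) (C : Config) (T : ℕ) (x : CCIndex ρ C T)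
    (E : Config) (t : ℕ) (v : E.Node) :
    ((stAcc ρ C T E t v).1 x, (stAcc ρ C T E t v).2) = stA0 (ρ x.1.1) x.2.1 E T t v := by
  induction t generalizing v with
  | zero => by_cases hv : v = E.gen <;> simp [stAcc, stA0, st, hv, Acc, A0]
  | succ t ih =>
    have h2 : (fun w => (stAcc ρ C T E t w).2) = fun w => (stA0 (ρ x.1.1) x.2.1 E T t w).2 :=
      funext fun w => congrArg Prod.snd (ih w)
    have h3 := congrArg Prod.snd (ih v)
    rw [stAcc_succ]
    simp only [funext ih, h2, ih v]
    rw [show (stAcc ρ C T E t v).2 = _ from h3]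
    have h := A0_next_pull (ρ x.1.1) x.2.1 E (stA0 (ρ x.1.1) x.2.1 E T t) v
    refine Prod.ext rfl ?_
    change _ = ((A0 T (ρ x.1.1) x.2.1).next (stA0 (ρ x.1.1) x.2.1 E T t v)
      (pull (stA0 (ρ x.1.1) x.2.1 E T t) v)).2
    rw [h]
    cases readTime (stA0 (ρ x.1.1) x.2.1 E T t v).2
      (pull (fun w => (stA0 (ρ x.1.1) x.2.1 E T t w).2) v) <;> rfl

theorem firing_Acc_iff {ρ : ∀ D : Config, PathRep D} {C : Config} {T : ℕ} {E : Config} {t : ℕ}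
    {v : E.Node} : st (Acc ρ C T) E t v ∈ (Acc ρ C T).firing ↔ ∃ x : CCIndex ρ C T,
      st (A0 T (ρ x.1.1) x.2.1) E t v ∈ (A0 T (ρ x.1.1) x.2.1).firing := by
  refine exists_congr fun x => ?_
  change _ ↔ stA0 (ρ x.1.1) x.2.1 E T t v ∈ (A0 T (ρ x.1.1) x.2.1).firing
  rw [← stAcc_eq]
  rfl

end FSSP

/-! ### Finiteness of the class, domain and firing time -/

theorem theorem19 (C : FSSP.Config) (T : ℕ) (hT : FSSP.IsMinFiringTime C T)
    (ρ : ∀ D : FSSP.Config, FSSP.PathRep D) :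
    {D | FSSP.Equivalent T C D}.Finite ∧
    FSSP.IsPartialSolution (FSSP.Acc ρ C T) ∧
    FSSP.domain (FSSP.Acc ρ C T) = {D | FSSP.Equivalent T C D} ∧
    ∀ D ∈ FSSP.domain (FSSP.Acc ρ C T), FSSP.FiresAt (FSSP.Acc ρ C T) D T := by
  open FSSP in
  obtain ⟨A, hA, hAC⟩ := hT.1
  have hd : ∀ D, Equivalent T C D → ∀ v, D.d D.gen v ≤ T := fun D hD =>
    dist_gen_le_of_firesAt (hAC.of_equivalent hA hD)
  have hfin : {D | Equivalent T C D}.Finite := (finite_setOf_dist_gen_le T).subset hd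
  have hu : ∀ D, Equivalent T C D → ∀ u, (ρ D).r ≤ u → u ≤ (ρ D).s → |u| ≤ T := by
    intro D hD u h1 h2
    have h3 := (ρ D).dist_eq ⟨(ρ D).r_nonpos, (ρ D).s_nonneg⟩ ⟨h1, h2⟩ (v := D.gen)
      (w := ⟨_, (ρ D).p_mem h1 h2⟩) (ρ D).p_zero rfl
    have h4 := hd D hD ⟨_, (ρ D).p_mem h1 h2⟩
    rw [zero_sub, abs_neg] at h3
    omega
  have hequiv : ∀ (E : Config) (t : ℕ) (v : E.Node),
      st (Acc ρ C T) E t v ∈ (Acc ρ C T).firing → Equivalent T C E := by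
    intro E t v h
    obtain ⟨⟨⟨D, hD⟩, ⟨u, h1, h2⟩⟩, hx⟩ := firing_Acc_iff.1 h
    exact hD.tail (step_of_firing_A0 (ρ D) E h1 h2 (hu D hD u h1 h2) hx)
  have hfires : ∀ D, Equivalent T C D → FiresAt (Acc ρ C T) D T := by
    intro D hD v
    constructor
    · intro t ht h
      obtain ⟨x, hx⟩ := firing_Acc_iff.1 h
      exact ht.ne (eq_of_firing_A0 _ _ _ hx)
    -- Each node is fired by the component indexed by `D` and its own position on the path.
    · obtain ⟨u, h1, h2, hv⟩ := (ρ D).exists_index v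
      exact firing_Acc_iff.2 ⟨⟨⟨D, hD⟩, ⟨u, h1, h2⟩⟩,
        firing_A0 (ρ D) h1 h2 (hu D hD u h1 h2) v hv⟩
  have hdom : domain (Acc ρ C T) = {D | Equivalent T C D} := by
    ext D
    exact ⟨fun ⟨t, ht⟩ => hequiv D t D.gen (ht D.gen).2, fun hD => ⟨T, hfires D hD⟩⟩
  refine ⟨hfin, ⟨?_, fun E => ?_⟩, hdom, fun D hD => hfires D (hdom.subset hD)⟩
  · have : Finite {D // Equivalent T C D} := hfin
    have (D : Config) : Finite {u : ℤ // (ρ D).r ≤ u ∧ u ≤ (ρ D).s} :=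
      Set.finite_Icc (ρ D).r (ρ D).s
    have : Finite (CCIndex ρ C T) := inferInstance
    exact inferInstanceAs (Finite ((CCIndex ρ C T → Bool × Bool) × Clock T))
  · by_cases hE : Equivalent T C E
    · exact Or.inl ⟨T, hfires E hE⟩
    · exact Or.inr fun v t h => hE (hequiv E t v h)
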